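/- Let $a,b\in\mathbb{Z}$ and $f(x)=ax^3+b$. For a positive integer $m$, call a residue class $r$ modulo $m$ $m$-allowable for $f$ if $\gcd(f(r),m)=1$, and let $A_m(f)$ be the number of $m$-allowable classes. Assume that $f$ produces infinitely many primes, i.e. infinitely many primes are of the form $f(n)$ with $n$ a positive integer, and that the primes produced by $f$ are uniformly distributed among allowable classes, i.e. for every positive integer $m$ and every class $r$ that is $m$-allowable for $f$, $$\lim_{x\to\infty}\frac{\#\{0\le n\le x:\ f(n)\text{ is prime and } n\equiv r \ (\mathrm{mod}\ m)\}}{\#\{0\le n\le x:\ f(n)\text{ is prime}\}}=\frac{1}{A_m(f)}.$$ Let $D$ be a fundamental discriminant, and put $$\tau_D^-(f)=\frac{\#\{r \ (\mathrm{mod}\ D):\ \left(\frac{D}{f(r)}\right)=-1\}}{\#\{r\ (\mathrm{mod}\ D):\ \gcd(f(r),D)=1\}},$$ where $\left(\frac{D}{\cdot}\right)$ is the Kronecker symbol. If $\tau_D^-(f)=1$, then $D\mid 56a$. -/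

import Mathlib

/-- The Kronecker symbol `(a / n)` for arbitrary integers `a`, `n`: for `n = u * 2 ^ e * m` with
`u = ±1` and `m` odd and positive it is `(a / u) * (a / 2) ^ e * (a / m)`, where
`(a / 1) = 1`, `(a / -1)` is `-1` if `a < 0` and `1` otherwise,
`(a / 2)` is `0` for even `a`, `1` for `a ≡ ±1 (mod 8)`, `-1` for `a ≡ ±3 (mod 8)`,
and `(a / m)` is the Jacobi symbol; moreover `(a / 0)` is `1` for `a = ±1` and `0` otherwise. -/
def kroneckerSymbol (a n : ℤ) : ℤ :=
  if n = 0 then (if a = 1 ∨ a = -1 then 1 else 0)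
  else (if a < 0 ∧ n < 0 then -1 else 1)
    * ZMod.χ₈ (a : ZMod 8) ^ padicValNat 2 n.natAbs
    * jacobiSym a (n.natAbs / 2 ^ padicValNat 2 n.natAbs)

/-- Fundamental discriminants: the discriminants of the fields `ℚ(√g)`
(the degenerate value `1` is allowed). -/
def IsFundamentalDiscriminant (D : ℤ) : Prop :=
  (D % 4 = 1 ∧ Squarefree D) ∨
    ∃ m : ℤ, D = 4 * m ∧ (m % 4 = 2 ∨ m % 4 = 3) ∧ Squarefree m

/-- The integer `k` is a (positive) prime number. -/
def IsPrimeNumber (k : ℤ) : Prop := ∃ p : ℕ, p.Prime ∧ k = (p : ℤ)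

/-- Infinitely many primes occur among the values of `f` at the positive integers. -/
def ProducesInfinitelyManyPrimes (f : Polynomial ℤ) : Prop :=
  {p : ℤ | IsPrimeNumber p ∧ ∃ n : ℤ, 0 < n ∧ f.eval n = p}.Infinite

/-- The class of `r` modulo `m` is `m`-allowable for `f`: `gcd (f(r), m) = 1`
(this depends on the class of `r` only). -/
def IsAllowable (f : Polynomial ℤ) (m : ℕ) (r : ℤ) : Prop :=
  Int.gcd (f.eval r) (m : ℤ) = 1

open Classical in
/-- The number of `m`-allowable residue classes for `f`, counted on `0, …, m - 1`. -/
noncomputable def allowableCount (f : Polynomial ℤ) (m : ℕ) : ℕ :=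
  ((Finset.range m).filter fun r : ℕ => IsAllowable f m (r : ℤ)).card

open Classical in
/-- `#{0 ≤ n ≤ x : f(n) is prime}`. -/
noncomputable def primeValueCount (f : Polynomial ℤ) (x : ℕ) : ℕ :=
  ((Finset.range (x + 1)).filter fun n : ℕ => IsPrimeNumber (f.eval (n : ℤ))).card

open Classical in
/-- `#{0 ≤ n ≤ x : f(n) is prime and n ≡ r (mod m)}`. -/
noncomputable def primeValueCountInClass (f : Polynomial ℤ) (m : ℕ) (r : ℤ) (x : ℕ) : ℕ :=
  ((Finset.range (x + 1)).filter fun n : ℕ =>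
    IsPrimeNumber (f.eval (n : ℤ)) ∧ (n : ℤ) ≡ r [ZMOD (m : ℤ)]).card

/-- For every modulus `m ≥ 1`, the integers `n ≥ 0` with `f(n)` prime are asymptotically uniformly
distributed over the `m`-allowable classes for `f`. -/
def PrimesUniformlyDistributed (f : Polynomial ℤ) : Prop :=
  ∀ m : ℕ, 0 < m → ∀ r : ℤ, IsAllowable f m r →
    Filter.Tendsto
      (fun x : ℕ => (primeValueCountInClass f m r x : ℝ) / (primeValueCount f x : ℝ))
      Filter.atTop (nhds (1 / (allowableCount f m : ℝ)))

/-- `τ_D⁻(f) = #{r mod D : (D / f(r)) = -1} / #{r mod D : gcd (f(r), D) = 1}`, with residue classes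
modulo `D` represented by `0, …, |D| - 1`. For a fundamental discriminant `D` the Kronecker symbol
`(D / ·)` is periodic modulo `|D|` on all integers, so the representatives do not matter. -/
noncomputable def tauMinus (D : ℤ) (f : Polynomial ℤ) : ℚ :=
  (((Finset.range D.natAbs).filter fun r : ℕ =>
      kroneckerSymbol D (f.eval (r : ℤ)) = -1).card : ℚ) /
    (((Finset.range D.natAbs).filter fun r : ℕ =>
      Int.gcd (f.eval (r : ℤ)) D = 1).card : ℚ)

/-! Write `D = e * m` with `e ∣ 8` and `m` squarefree, so that it suffices to show that every prime
`p ∣ m` other than 7 divides `a`. If `p ∤ a`, the quadratic character mod `p` takes both signs on `a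
x³ + b`. The Kronecker symbol at `D` is `(n/p)` times a function of `n` mod `|D|/p`, a modulus
coprime to `p`. By CRT both signs occur with the second factor frozen at a value coprime to `D`, so
the symbol cannot always be `-1` (`dvd_of_tauMinus_eq_one`).

Both signs occur because averaging over `c` gives `S(a)² ≤ 6q` for `S(c) = ∑ χ(c x³ + b)`, which
rules out constancy for `q ≥ 12`; for 3, 5 and 11 cubing is bijective. The prime 7 is a true
exception: mod 7, `4x³ + 3` takes only the values 0, 3, 6, and 3 and 6 are nonresidues. -/

/-! ### Quadratic character sums along cubics over finite fields -/

lemma card_cube_fiber_le {F : Type*} [Field F] [Fintype F] [DecidableEq F] (v : F) :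
    (Finset.univ.filter fun x : F => x ^ 3 = v).card ≤ 3 := by
  have h : (Finset.univ.filter fun x : F => x ^ 3 = v) ⊆ (Polynomial.nthRoots 3 v).toFinset := by
    intro x hx
    simpa [Polynomial.mem_nthRoots] using hx
  exact (Finset.card_le_card h).trans
    ((Multiset.toFinset_card_le _).trans (Polynomial.card_nthRoots 3 v))

lemma card_cube_eq_zero_fiber {F : Type*} [Field F] [Fintype F] [DecidableEq F] :
    (Finset.univ.filter fun x : F => x ^ 3 = 0).card = 1 := by
  rw [Finset.card_eq_one]
  exact ⟨0, by ext x; simp⟩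

section SecondMoment

variable {F : Type*} [Field F] [Fintype F] [DecidableEq F]

lemma quadraticChar_sum_mul_affine_of_ne (hF : ringChar F ≠ 2) {b X Y : F} (hb : b ≠ 0)
    (hX : X ≠ 0) (hY : Y ≠ 0) (hXY : X ≠ Y) :
    ∑ c : F, quadraticChar F (c * X + b) * quadraticChar F (c * Y + b) =
      -quadraticChar F (X * Y) := by
  have hs : b / X - b / Y ≠ 0 := by
    rw [div_sub_div _ _ hX hY]
    refine div_ne_zero ?_ (mul_ne_zero hX hY)
    rw [mul_comm X b, ← mul_sub]
    exact mul_ne_zero hb (sub_ne_zero.2 hXY.symm)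
  -- The affine change of variable sends 0 and 1 to the roots `-b/X` and `-b/Y`, turning the sum
  -- into the Jacobi sum of `χ` with `χ = χ⁻¹`.
  let e : F ≃ F := (Equiv.mulRight₀ _ hs).trans (Equiv.addRight (-(b / X)))
  rw [← e.sum_comp]
  have key : ∀ z : F, quadraticChar F (e z * X + b) * quadraticChar F (e z * Y + b) =
      quadraticChar F (-1) * quadraticChar F (X * Y) *
        (quadraticChar F z * quadraticChar F (1 - z)) := by
    intro z
    have h1 : (e z * X + b) * (e z * Y + b) =
        (-1) * (X * Y) * (z * (1 - z)) * (b * (X - Y) / (X * Y)) ^ 2 := by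
      have he : e z = z * (b / X - b / Y) + -(b / X) := rfl
      rw [he]
      field_simp
      ring
    have h2 : b * (X - Y) / (X * Y) ≠ 0 :=
      div_ne_zero (mul_ne_zero hb (sub_ne_zero.2 hXY)) (mul_ne_zero hX hY)
    rw [← map_mul, h1, map_mul, map_mul, map_mul, map_mul _ z, quadraticChar_sq_one' h2, mul_one]
  simp_rw [key]
  rw [← Finset.mul_sum]
  have hJ := jacobiSum_nontrivial_inv (quadraticChar_ne_one hF)
  rw [(quadraticChar_isQuadratic F).inv] at hJ
  unfold jacobiSum at hJ
  rw [hJ]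
  have : quadraticChar F (-1) * quadraticChar F (-1) = 1 := by
    rw [← map_mul]; simp
  linear_combination (-quadraticChar F (X * Y)) * this

lemma quadraticChar_sum_affine (hF : ringChar F ≠ 2) {X : F} (b : F) (hX : X ≠ 0) :
    ∑ c : F, quadraticChar F (c * X + b) = 0 := by
  rw [← quadraticChar_sum_zero hF]
  exact ((Equiv.mulRight₀ _ hX).trans (Equiv.addRight b)).sum_comp (quadraticChar F)

lemma quadraticChar_sum_sq_affine {X : F} (b : F) (hX : X ≠ 0) :
    ∑ c : F, quadraticChar F (c * X + b) ^ 2 = (Fintype.card F : ℤ) - 1 := by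
  have h := ((Equiv.mulRight₀ _ hX).trans (Equiv.addRight b)).sum_comp
    (fun z => quadraticChar F z ^ 2)
  refine h.trans ?_
  rw [← Finset.add_sum_erase _ _ (Finset.mem_univ (0 : F)),
    Finset.sum_congr rfl (fun z hz => quadraticChar_sq_one (Finset.ne_of_mem_erase hz))]
  simp [Finset.card_erase_of_mem, Nat.cast_sub Fintype.card_pos]

lemma quadraticChar_sum_mul_affine (hF : ringChar F ≠ 2) {b : F} (hb : b ≠ 0) (X Y : F) :
    ∑ c : F, quadraticChar F (c * X + b) * quadraticChar F (c * Y + b) =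
      (if X = Y then (Fintype.card F : ℤ) else 0) - quadraticChar F X * quadraticChar F Y := by
  by_cases hX : X = 0
  · by_cases hY : Y = 0
    · simp [-quadraticChar_apply, MulChar.map_zero, hX, hY, ← sq, quadraticChar_sq_one hb]
    · simp [-quadraticChar_apply, MulChar.map_zero, hX, Ne.symm hY, ← Finset.mul_sum, quadraticChar_sum_affine hF b hY]
  · by_cases hY : Y = 0
    · simp [-quadraticChar_apply, MulChar.map_zero, hX, hY, ← Finset.sum_mul, quadraticChar_sum_affine hF b hX]
    · by_cases hXY : X = Y
      · subst hXY
        simp [-quadraticChar_apply, ← sq, quadraticChar_sum_sq_affine b hX, quadraticChar_sq_one hX]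
      · simp [-quadraticChar_apply, hXY, quadraticChar_sum_mul_affine_of_ne hF hb hX hY hXY]

/-- The character sum of the quadratic character along `c * x ^ 3 + b`. -/
def cubicCharSum (b c : F) : ℤ := ∑ x : F, quadraticChar F (c * x ^ 3 + b)

lemma card_cube_pairs_le :
    ∑ x : F, ∑ y : F, (if x ^ 3 = y ^ 3 then (1 : ℤ) else 0) ≤ 3 * (Fintype.card F : ℤ) - 2 := by
  rw [Finset.sum_comm]
  have h : ∀ y : F, ∑ x : F, (if x ^ 3 = y ^ 3 then (1 : ℤ) else 0) =
      (Finset.univ.filter fun x : F => x ^ 3 = y ^ 3).card := by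
    intro y; simp
  simp_rw [h]
  rw [← Finset.add_sum_erase _ _ (Finset.mem_univ (0 : F))]
  have h0 : (Finset.univ.filter fun x : F => x ^ 3 = (0 : F) ^ 3).card = 1 := by
    rw [zero_pow three_ne_zero]; exact card_cube_eq_zero_fiber
  rw [h0]
  have h1 := Finset.sum_le_card_nsmul (Finset.univ.erase (0 : F))
    (fun y => ((Finset.univ.filter fun x : F => x ^ 3 = y ^ 3).card : ℤ)) 3
    (fun y _ => by exact_mod_cast card_cube_fiber_le (y ^ 3))
  rw [Finset.card_erase_of_mem (Finset.mem_univ _), Finset.card_univ, nsmul_eq_mul,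
    Nat.cast_sub Fintype.card_pos] at h1
  push_cast at h1 ⊢
  linarith

lemma sum_quadraticChar_cube (hF : ringChar F ≠ 2) : ∑ x : F, quadraticChar F (x ^ 3) = 0 := by
  rw [← quadraticChar_sum_zero hF]
  refine Finset.sum_congr rfl fun x _ => ?_
  by_cases hx : x = 0
  · simp [hx]
  · rw [pow_succ, map_mul, quadraticChar_sq_one' hx, one_mul]

/-- Expand the square and sum over `c` first: only pairs with `x³ = y³` survive, giving at most
`q(3q - 2)`. The term `c = 0` contributes exactly `q²` and is removed. -/
lemma sum_sq_cubicCharSum_le (hF : ringChar F ≠ 2) {b : F} (hb : b ≠ 0) :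
    ∑ c ∈ Finset.univ.erase (0 : F), cubicCharSum b c ^ 2 ≤
      2 * (Fintype.card F : ℤ) * ((Fintype.card F : ℤ) - 1) := by
  have hzero : cubicCharSum b 0 ^ 2 = (Fintype.card F : ℤ) ^ 2 := by
    simp [-quadraticChar_apply, cubicCharSum, mul_pow, quadraticChar_sq_one hb]
  have htot : ∑ c : F, cubicCharSum b c ^ 2 =
      (Fintype.card F : ℤ) * ∑ x : F, ∑ y : F, (if x ^ 3 = y ^ 3 then (1 : ℤ) else 0) := by
    have h1 : ∀ c : F, cubicCharSum b c ^ 2 = ∑ x : F, ∑ y : F,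
        quadraticChar F (c * x ^ 3 + b) * quadraticChar F (c * y ^ 3 + b) := by
      intro c
      rw [sq, cubicCharSum, Finset.sum_mul_sum]
    simp_rw [h1]
    rw [Finset.sum_comm]
    have h2 : ∀ x : F, ∑ c : F, ∑ y : F,
        quadraticChar F (c * x ^ 3 + b) * quadraticChar F (c * y ^ 3 + b) =
        ∑ y : F, ((if x ^ 3 = y ^ 3 then (Fintype.card F : ℤ) else 0) -
          quadraticChar F (x ^ 3) * quadraticChar F (y ^ 3)) := by
      intro x
      rw [Finset.sum_comm]
      exact Finset.sum_congr rfl fun y _ => quadraticChar_sum_mul_affine hF hb _ _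
    simp_rw [h2, Finset.sum_sub_distrib, ← Finset.mul_sum, sum_quadraticChar_cube hF, mul_zero,
      Finset.sum_const_zero, sub_zero, Finset.mul_sum, mul_ite, mul_one, mul_zero]
  rw [← Finset.add_sum_erase _ _ (Finset.mem_univ (0 : F)), hzero] at htot
  have hq : (0 : ℤ) ≤ Fintype.card F := by positivity
  nlinarith [mul_le_mul_of_nonneg_left (card_cube_pairs_le (F := F)) hq]

lemma cubicCharSum_mul_cube (b c : F) {g : F} (hg : g ≠ 0) :
    cubicCharSum b (c * g ^ 3) = cubicCharSum b c := by
  unfold cubicCharSum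
  refine Eq.trans (Finset.sum_congr rfl fun x _ => ?_)
    (Equiv.sum_comp (Equiv.mulLeft₀ g hg) (fun x => quadraticChar F (c * x ^ 3 + b)))
  change _ = quadraticChar F (c * (g * x) ^ 3 + b)
  rw [mul_pow, mul_assoc]

/-- The sum is unchanged when `a` is replaced by `a g³`, and each `c` equals `a g³` for at most 3
values of `g`. So `(q - 1) S(a)²` is at most 3 times the second moment `2q(q - 1)`. -/
lemma sq_cubicCharSum_le (hF : ringChar F ≠ 2) {a b : F} (ha : a ≠ 0) (hb : b ≠ 0) :
    cubicCharSum b a ^ 2 ≤ 6 * (Fintype.card F : ℤ) := by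
  have hq : (1 : ℤ) < Fintype.card F := by exact_mod_cast Fintype.one_lt_card
  have h1 : ∑ g ∈ Finset.univ.erase (0 : F), cubicCharSum b (a * g ^ 3) ^ 2 =
      ((Fintype.card F : ℤ) - 1) * cubicCharSum b a ^ 2 := by
    have h : ∀ g ∈ Finset.univ.erase (0 : F),
        cubicCharSum b (a * g ^ 3) ^ 2 = cubicCharSum b a ^ 2 := fun g hg => by
      rw [cubicCharSum_mul_cube b a (Finset.ne_of_mem_erase hg)]
    rw [Finset.sum_congr rfl h]
    simp [Finset.card_erase_of_mem, Nat.cast_sub Fintype.card_pos]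
  have hmaps : ∀ g ∈ Finset.univ.erase (0 : F), a * g ^ 3 ∈ Finset.univ.erase (0 : F) := by
    intro g hg
    exact Finset.mem_erase.2 ⟨mul_ne_zero ha (pow_ne_zero 3 (Finset.ne_of_mem_erase hg)),
      Finset.mem_univ _⟩
  rw [← Finset.sum_fiberwise_of_maps_to hmaps] at h1
  have h2 : ∀ c ∈ Finset.univ.erase (0 : F),
      ∑ g ∈ (Finset.univ.erase (0 : F)).filter (fun g => a * g ^ 3 = c),
        cubicCharSum b (a * g ^ 3) ^ 2 ≤ 3 * cubicCharSum b c ^ 2 := by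
    intro c _
    rw [Finset.sum_congr rfl fun g hg => by rw [(Finset.mem_filter.1 hg).2], Finset.sum_const,
      nsmul_eq_mul]
    have hsub : (Finset.univ.erase (0 : F)).filter (fun g => a * g ^ 3 = c) ⊆
        Finset.univ.filter fun g => g ^ 3 = c / a := by
      intro g hg
      have := (Finset.mem_filter.1 hg).2
      simp [← this, mul_div_cancel_left₀ _ ha]
    have hc : ((((Finset.univ.erase (0 : F)).filter (fun g => a * g ^ 3 = c)).card : ℕ) : ℤ) ≤ 3 :=
      by exact_mod_cast (Finset.card_le_card hsub).trans (card_cube_fiber_le _)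
    exact mul_le_mul_of_nonneg_right hc (sq_nonneg _)
  have h3 := Finset.sum_le_sum h2
  rw [h1, ← Finset.mul_sum] at h3
  have h4 := sum_sq_cubicCharSum_le hF hb
  have h5 : ((Fintype.card F : ℤ) - 1) * cubicCharSum b a ^ 2 ≤
      ((Fintype.card F : ℤ) - 1) * (6 * (Fintype.card F : ℤ)) := by linarith
  exact le_of_mul_le_mul_left h5 (by linarith)

lemma card_sub_three_le_sum_sq {a b : F} (ha : a ≠ 0) :
    (Fintype.card F : ℤ) - 3 ≤ ∑ x : F, quadraticChar F (a * x ^ 3 + b) ^ 2 := by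
  have h1 : ∀ x : F, quadraticChar F (a * x ^ 3 + b) ^ 2 =
      1 - if x ^ 3 = -b / a then 1 else 0 := by
    intro x
    have : x ^ 3 = -b / a ↔ a * x ^ 3 + b = 0 := by
      rw [eq_div_iff ha, eq_neg_iff_add_eq_zero, mul_comm]
    by_cases h : a * x ^ 3 + b = 0
    · rw [if_pos (this.2 h), h]; simp
    · rw [if_neg (mt this.1 h), quadraticChar_sq_one h, sub_zero]
  simp_rw [h1]
  rw [Finset.sum_sub_distrib, Finset.sum_boole]
  have := card_cube_fiber_le (-b / a)
  simp only [Finset.sum_const, Finset.card_univ, nsmul_eq_mul, mul_one]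
  have h3 : ((Finset.univ.filter fun x : F => x ^ 3 = -b / a).card : ℤ) ≤ 3 := by
    exact_mod_cast this
  linarith

/-- Over a field with at least twelve elements, `a * x ^ 3 + b` with `a * b ≠ 0` does not have
constant quadratic character away from its zeros. -/
lemma exists_quadraticChar_cubic_of_twelve_le (hF : ringChar F ≠ 2) {a b : F} (ha : a ≠ 0)
    (hb : b ≠ 0) (hq : 12 ≤ Fintype.card F) {ε : ℤ} (hε : ε = 1 ∨ ε = -1) :
    ∃ x : F, quadraticChar F (a * x ^ 3 + b) = ε := by
  by_contra! hne
  have h1 : cubicCharSum b a = -ε * ∑ x : F, quadraticChar F (a * x ^ 3 + b) ^ 2 := by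
    rw [cubicCharSum, Finset.mul_sum]
    refine Finset.sum_congr rfl fun x _ => ?_
    by_cases h : a * x ^ 3 + b = 0
    · simp [h]
    · rw [quadraticChar_sq_one h, mul_one]
      have := hne x
      rcases hε with h' | h' <;>
        rcases quadraticChar_dichotomy h with h'' | h'' <;> simp_all
  have h2 := sq_cubicCharSum_le hF ha hb
  have hε2 : ε ^ 2 = 1 := by rcases hε with rfl | rfl <;> norm_num
  rw [h1, mul_pow, neg_sq, hε2, one_mul] at h2
  have h3 := card_sub_three_le_sum_sq (b := b) ha
  have h4 : (12 : ℤ) ≤ Fintype.card F := by exact_mod_cast hq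
  -- Constancy would give `(q - 3)² ≤ 6q`, which fails from `q = 12` on but not at 11.
  nlinarith

lemma exists_quadraticChar_cubic_of_surjective (hF : ringChar F ≠ 2) {a : F} (b : F) (ha : a ≠ 0)
    (hcube : ∀ y : F, ∃ x : F, x ^ 3 = y) {ε : ℤ} (hε : ε = 1 ∨ ε = -1) :
    ∃ x : F, quadraticChar F (a * x ^ 3 + b) = ε := by
  obtain ⟨y, hy⟩ : ∃ y : F, quadraticChar F y = ε := by
    rcases hε with rfl | rfl
    · exact ⟨1, by simp⟩
    · exact quadraticChar_exists_neg_one hF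
  obtain ⟨x, hx⟩ := hcube ((y - b) / a)
  exact ⟨x, by rw [hx, mul_div_cancel₀ _ ha, sub_add_cancel, hy]⟩

lemma exists_quadraticChar_mul_cube (hF : ringChar F ≠ 2) {a : F} (ha : a ≠ 0)
    {ε : ℤ} (hε : ε = 1 ∨ ε = -1) : ∃ x : F, quadraticChar F (a * x ^ 3) = ε := by
  have key : ∀ y : F, y ≠ 0 → quadraticChar F (a * y ^ 3) = quadraticChar F (a * y) := by
    intro y hy
    -- `a y³` and `a y` differ by the square `y²`.
    rw [pow_succ, ← mul_assoc, mul_right_comm, map_mul, quadraticChar_sq_one' hy, mul_one]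
  obtain ⟨z, hz⟩ : ∃ z : F, quadraticChar F z = ε := by
    rcases hε with rfl | rfl
    · exact ⟨1, by simp⟩
    · exact quadraticChar_exists_neg_one hF
  have hz0 : z ≠ 0 := by
    rintro rfl
    rw [MulChar.map_zero] at hz
    rcases hε with rfl | rfl <;> norm_num at hz
  exact ⟨z / a, by rw [key _ (div_ne_zero hz0 ha), mul_div_cancel₀ _ ha, hz]⟩

end SecondMoment

lemma exists_quadraticChar_cubic_zmod {p : ℕ} [Fact p.Prime] (hp2 : p ≠ 2) (hp7 : p ≠ 7)
    {a : ZMod p} (b : ZMod p) (ha : a ≠ 0) {ε : ℤ} (hε : ε = 1 ∨ ε = -1) :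
    ∃ x : ZMod p, quadraticChar (ZMod p) (a * x ^ 3 + b) = ε := by
  have hF : ringChar (ZMod p) ≠ 2 := by rwa [ZMod.ringChar_zmod_n]
  by_cases hb : b = 0
  · simpa [hb] using exists_quadraticChar_mul_cube hF ha hε
  by_cases hq : 12 ≤ p
  · exact exists_quadraticChar_cubic_of_twelve_le hF ha hb (by rwa [ZMod.card]) hε
  refine exists_quadraticChar_cubic_of_surjective hF b ha ?_ hε
  have hp : p.Prime := Fact.out
  push Not at hq
  have h3 : ∀ y : ZMod 3, ∃ x, x ^ 3 = y := by decide
  have h5 : ∀ y : ZMod 5, ∃ x, x ^ 3 = y := by decide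
  have h11 : ∀ y : ZMod 11, ∃ x, x ^ 3 = y := by decide
  clear hF ha hb
  interval_cases p <;> first | exact h3 | exact h5 | exact h11 | (exfalso; revert hp; norm_num; done) | omega

/-! ### Kronecker symbols at fundamental discriminants -/

open scoped NumberTheorySymbols

lemma natAbs_div_pow_odd {n : ℤ} (hn : n ≠ 0) :
    Odd (n.natAbs / 2 ^ padicValNat 2 n.natAbs) := by
  rw [← Nat.not_even_iff_odd, even_iff_two_dvd, ← Nat.factorization_def _ Nat.prime_two]
  exact Nat.not_dvd_ordCompl Nat.prime_two (Int.natAbs_ne_zero.2 hn)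

lemma natAbs_eq_pow_mul (n : ℤ) :
    n.natAbs = 2 ^ padicValNat 2 n.natAbs * (n.natAbs / 2 ^ padicValNat 2 n.natAbs) :=
  (Nat.mul_div_cancel' pow_padicValNat_dvd).symm

lemma kroneckerSymbol_of_ne_zero {a n : ℤ} (hn : n ≠ 0) :
    kroneckerSymbol a n = (if a < 0 ∧ n < 0 then -1 else 1)
      * ZMod.χ₈ (a : ZMod 8) ^ padicValNat 2 n.natAbs
      * jacobiSym a (n.natAbs / 2 ^ padicValNat 2 n.natAbs) := by
  rw [kroneckerSymbol, if_neg hn]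

lemma kroneckerSymbol_mul_left {a b n : ℤ} (ha : a ≠ 0) (hb : b ≠ 0) (hn : n ≠ 0) :
    kroneckerSymbol (a * b) n = kroneckerSymbol a n * kroneckerSymbol b n := by
  simp only [kroneckerSymbol_of_ne_zero hn, Int.cast_mul, map_mul, mul_pow, jacobiSym.mul_left]
  have h : (if a * b < 0 ∧ n < 0 then (-1 : ℤ) else 1) =
      (if a < 0 ∧ n < 0 then -1 else 1) * (if b < 0 ∧ n < 0 then -1 else 1) := by
    rcases lt_or_gt_of_ne ha with h1 | h1 <;> rcases lt_or_gt_of_ne hb with h2 | h2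
    · have := mul_pos_of_neg_of_neg h1 h2
      by_cases hn0 : n < 0 <;> simp [h1, h2, this.not_gt, hn0]
    · have := mul_neg_of_neg_of_pos h1 h2
      by_cases hn0 : n < 0 <;> simp [h1, h2.not_gt, this, hn0]
    · have := mul_neg_of_pos_of_neg h1 h2
      by_cases hn0 : n < 0 <;> simp [h1.not_gt, h2, this, hn0]
    · have := mul_pos h1 h2
      by_cases hn0 : n < 0 <;> simp [h1.not_gt, h2.not_gt, this.not_gt, hn0]
  rw [h]
  ring

lemma kroneckerSymbol_eq_zero_of_gcd_ne_one {a n : ℤ} (ha : ¬IsUnit a) (h : Int.gcd n a ≠ 1) :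
    kroneckerSymbol a n = 0 := by
  by_cases hn : n = 0
  · rw [Int.isUnit_iff] at ha
    rw [kroneckerSymbol, if_pos hn, if_neg ha]
  rw [kroneckerSymbol_of_ne_zero hn]
  obtain ⟨q, hq, hqd⟩ := Nat.exists_prime_and_dvd h
  have hqn : q ∣ n.natAbs := hqd.trans (Int.gcd_dvd_natAbs_left _ _)
  have hqa : (q : ℤ) ∣ a := (Int.natCast_dvd_natCast.2 hqd).trans (Int.gcd_dvd_right _ _)
  by_cases hq2 : q = 2
  · subst hq2
    have hv : padicValNat 2 n.natAbs ≠ 0 := by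
      have := one_le_padicValNat_of_dvd (Int.natAbs_ne_zero.2 hn) hqn
      omega
    have hχ : ZMod.χ₈ (a : ZMod 8) = 0 := by
      rw [ZMod.χ₈_int_eq_if_mod_eight, if_pos (by exact_mod_cast Int.emod_eq_zero_of_dvd hqa)]
    rw [hχ, zero_pow hv, mul_zero, zero_mul]
  · have hqm : q ∣ n.natAbs / 2 ^ padicValNat 2 n.natAbs := by
      rw [natAbs_eq_pow_mul n] at hqn
      refine (Nat.Coprime.dvd_of_dvd_mul_left ?_ hqn)
      exact Nat.Coprime.pow_right _ ((Nat.coprime_primes hq Nat.prime_two).2 hq2)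
    have hJ : jacobiSym a (n.natAbs / 2 ^ padicValNat 2 n.natAbs) = 0 := by
      rw [jacobiSym.eq_zero_iff]
      refine ⟨(natAbs_div_pow_odd hn).pos.ne', fun h1 => hq.one_lt.ne' ?_⟩
      exact Nat.dvd_one.1 (h1 ▸ Int.dvd_gcd hqa (Int.natCast_dvd_natCast.2 hqm))
    rw [hJ, mul_zero]

/-- For `d < 0` we have `|d| ≡ 3 (mod 4)`, and the reciprocity sign cancels against `(-1/k)`. -/
lemma jacobiSym_natAbs_flip {d : ℤ} (hd : d % 4 = 1) {k : ℕ} (hk : Odd k) :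
    J(k | d.natAbs) = J(d | k) := by
  rcases le_or_gt 0 d with h | h
  · lift d to ℕ using h
    rw [Int.natAbs_natCast]
    exact (jacobiSym.quadratic_reciprocity_one_mod_four (by omega) hk).symm
  · obtain ⟨e, rfl⟩ : ∃ e : ℕ, d = -(e : ℤ) := ⟨d.natAbs, by omega⟩
    rw [Int.natAbs_neg, Int.natAbs_natCast, jacobiSym.neg _ hk]
    have he : e % 4 = 3 := by omega
    have he' : Odd e := Nat.odd_iff.2 (by omega)
    rcases Nat.odd_mod_four_iff.1 (Nat.odd_iff.1 hk) with hk4 | hk4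
    · rw [ZMod.χ₄_nat_one_mod_four hk4, one_mul,
        jacobiSym.quadratic_reciprocity_one_mod_four hk4 he']
    · rw [ZMod.χ₄_nat_three_mod_four hk4, jacobiSym.quadratic_reciprocity_three_mod_four hk4 he]
      ring

lemma jacobiSym_neg_one_natAbs {d : ℤ} (hd : d % 4 = 1) :
    J(-1 | d.natAbs) = if d < 0 then -1 else 1 := by
  rw [jacobiSym.at_neg_one (Nat.odd_iff.2 (by omega))]
  split_ifs with h
  · exact ZMod.χ₄_nat_three_mod_four (by omega)
  · exact ZMod.χ₄_nat_one_mod_four (by omega)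

lemma jacobiSym_two_natAbs {d : ℤ} (hd : d % 4 = 1) :
    J(2 | d.natAbs) = ZMod.χ₈ (d : ZMod 8) := by
  rw [jacobiSym.at_two (Nat.odd_iff.2 (by omega)), ZMod.χ₈_int_eq_if_mod_eight,
    ZMod.χ₈_nat_eq_if_mod_eight]
  split_ifs <;> first | rfl | omega

/-- The sign, the power of 2 and the odd part of `n` are flipped separately. The result shows that
the symbol is periodic in `n` modulo `|d|` and splits over the primes of `d`. -/
lemma kroneckerSymbol_of_one_mod_four {d n : ℤ} (hd : d % 4 = 1) (hn : n ≠ 0) :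
    kroneckerSymbol d n = J(n | d.natAbs) := by
  rw [kroneckerSymbol_of_ne_zero hn, ← jacobiSym_natAbs_flip hd (natAbs_div_pow_odd hn),
    ← jacobiSym_two_natAbs hd, ← jacobiSym.pow_left, mul_assoc, ← jacobiSym.mul_left]
  have h2 : (2 : ℤ) ^ padicValNat 2 n.natAbs *
      ((n.natAbs / 2 ^ padicValNat 2 n.natAbs : ℕ) : ℤ) = (n.natAbs : ℤ) := by
    exact_mod_cast (natAbs_eq_pow_mul n).symm
  rw [h2]
  rcases lt_or_gt_of_ne hn with h | h
  · have h3 : n = -1 * (n.natAbs : ℤ) := by omega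
    conv_rhs => rw [h3, jacobiSym.mul_left, jacobiSym_neg_one_natAbs hd]
    simp [h]
  · have h3 : (n.natAbs : ℤ) = n := by omega
    rw [h3, if_neg (by omega), one_mul]

lemma kroneckerSymbol_of_odd_right {a n : ℤ} (hn : Odd n) :
    kroneckerSymbol a n = (if a < 0 ∧ n < 0 then -1 else 1) * J(a | n.natAbs) := by
  have h0 : n ≠ 0 := by rintro rfl; simp at hn
  have hv : padicValNat 2 n.natAbs = 0 :=
    padicValNat.eq_zero_of_not_dvd (by rw [← even_iff_two_dvd, Nat.not_even_iff_odd]; exact hn.natAbs)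
  rw [kroneckerSymbol_of_ne_zero h0, hv]
  simp

lemma χ₄_natAbs {n : ℤ} (hn : Odd n) :
    ZMod.χ₄ (n.natAbs : ZMod 4) * (if n < 0 then -1 else 1) = ZMod.χ₄ (n : ZMod 4) := by
  have h := Int.odd_iff.1 hn
  rw [ZMod.χ₄_nat_eq_if_mod_four, ZMod.χ₄_int_eq_if_mod_four]
  split_ifs <;> first | rfl | omega

lemma χ₈_natAbs {n : ℤ} (hn : Odd n) :
    ZMod.χ₈ (n.natAbs : ZMod 8) = ZMod.χ₈ (n : ZMod 8) := by
  have h := Int.odd_iff.1 hn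
  rw [ZMod.χ₈_nat_eq_if_mod_eight, ZMod.χ₈_int_eq_if_mod_eight]
  split_ifs <;> first | rfl | omega

lemma χ₈'_natAbs {n : ℤ} (hn : Odd n) :
    ZMod.χ₈' (n.natAbs : ZMod 8) * (if n < 0 then -1 else 1) = ZMod.χ₈' (n : ZMod 8) := by
  have h := Int.odd_iff.1 hn
  rw [ZMod.χ₈'_nat_eq_if_mod_eight, ZMod.χ₈'_int_eq_if_mod_eight]
  split_ifs <;> first | rfl | omega

lemma kroneckerSymbol_neg_four {n : ℤ} (hn : Odd n) :
    kroneckerSymbol (-4) n = ZMod.χ₄ (n : ZMod 4) := by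
  rw [kroneckerSymbol_of_odd_right hn, ← χ₄_natAbs hn, jacobiSym.neg _ hn.natAbs,
    jacobiSym.at_four hn.natAbs]
  simp [mul_comm]

lemma kroneckerSymbol_eight {n : ℤ} (hn : Odd n) :
    kroneckerSymbol 8 n = ZMod.χ₈ (n : ZMod 8) := by
  rw [kroneckerSymbol_of_odd_right hn, ← χ₈_natAbs hn, show (8 : ℤ) = 4 * 2 by norm_num,
    jacobiSym.mul_left, jacobiSym.at_four hn.natAbs, jacobiSym.at_two hn.natAbs]
  simp

lemma kroneckerSymbol_neg_eight {n : ℤ} (hn : Odd n) :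
    kroneckerSymbol (-8) n = ZMod.χ₈' (n : ZMod 8) := by
  rw [kroneckerSymbol_of_odd_right hn, ← χ₈'_natAbs hn, show (-8 : ℤ) = 4 * -2 by norm_num,
    jacobiSym.mul_left, jacobiSym.at_four hn.natAbs, jacobiSym.at_neg_two hn.natAbs]
  simp [mul_comm]

lemma squarefree_int_neg {m : ℤ} (h : Squarefree m) : Squarefree (-m) := by
  rwa [← Int.squarefree_natAbs, Int.natAbs_neg, Int.squarefree_natAbs]

/-- A fundamental discriminant is `e * m` with `m ≡ 1 (mod 4)` squarefree and `e` a power of two up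
to sign, such that the Kronecker symbol at `e` is periodic modulo `e`. -/
lemma IsFundamentalDiscriminant.exists_eq_mul {D : ℤ} (hD : IsFundamentalDiscriminant D) :
    ∃ e m : ℤ, D = e * m ∧ m % 4 = 1 ∧ Squarefree m ∧ e ∣ 8 ∧
      ∃ ψ : ℤ → ℤ, (∀ n₁ n₂, n₁ ≡ n₂ [ZMOD e] → ψ n₁ = ψ n₂) ∧
        ∀ n, n ≠ 0 → Int.gcd n D = 1 → kroneckerSymbol e n = ψ n := by
  have hodd : ∀ {n : ℤ}, (2 : ℤ) ∣ D → Int.gcd n D = 1 → Odd n := by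
    intro n h2 h
    rw [← Int.not_even_iff_odd, even_iff_two_dvd]
    intro hn
    have := Int.dvd_gcd hn h2
    rw [h] at this
    norm_num at this
  have hcast : ∀ (k : ℕ) {n₁ n₂ e : ℤ}, n₁ ≡ n₂ [ZMOD e] → (k : ℤ) ∣ e →
      (n₁ : ZMod k) = (n₂ : ZMod k) := by
    intro k n₁ n₂ e h hk
    exact (ZMod.intCast_eq_intCast_iff _ _ _).2 (h.of_dvd hk)
  rcases hD with ⟨h1, hs⟩ | ⟨k, rfl, hk, hs⟩
  · refine ⟨1, D, by ring, h1, hs, by norm_num, fun _ => 1, fun _ _ _ => rfl, fun n hn _ => ?_⟩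
    rw [kroneckerSymbol_of_one_mod_four (by norm_num) hn]
    simp
  have h2 : (2 : ℤ) ∣ 4 * k := ⟨2 * k, by ring⟩
  rcases hk with hk | hk
  · obtain ⟨j, rfl⟩ : ∃ j, k = 2 * j := ⟨k / 2, by omega⟩
    have hsj : Squarefree j := hs.squarefree_of_dvd (Dvd.intro_left _ rfl)
    have hj : j % 4 = 1 ∨ (-j) % 4 = 1 := by omega
    rcases hj with hj | hj
    · exact ⟨8, j, by ring, hj, hsj, by norm_num, fun n => ZMod.χ₈ (n : ZMod 8),
        fun _ _ h => congrArg _ (hcast 8 h (by norm_num)),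
        fun n _ h => kroneckerSymbol_eight (hodd h2 h)⟩
    · exact ⟨-8, -j, by ring, hj, squarefree_int_neg hsj, by norm_num, fun n => ZMod.χ₈' (n : ZMod 8),
        fun _ _ h => congrArg _ (hcast 8 h (by norm_num)),
        fun n _ h => kroneckerSymbol_neg_eight (hodd h2 h)⟩
  · exact ⟨-4, -k, by ring, by omega, squarefree_int_neg hs, by norm_num, fun n => ZMod.χ₄ (n : ZMod 4),
      fun _ _ h => congrArg _ (hcast 4 h (by norm_num)),
      fun n _ h => kroneckerSymbol_neg_four (hodd h2 h)⟩

lemma IsFundamentalDiscriminant.exists_jacobiSym_mul {D : ℤ} (hD : IsFundamentalDiscriminant D)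
    {p : ℕ} (hp : p.Prime) (hp2 : p ≠ 2) (hpD : (p : ℤ) ∣ D) :
    ∃ M : ℕ, D.natAbs = p * M ∧ p.Coprime M ∧
      ∃ ψ : ℤ → ℤ, (∀ n₁ n₂, n₁ ≡ n₂ [ZMOD M] → ψ n₁ = ψ n₂) ∧
        ∀ n, Int.gcd n D = 1 → kroneckerSymbol D n = J(n | p) * ψ n := by
  obtain ⟨e, m, rfl, hm4, hsm, he8, ψ, hψ, hκ⟩ := hD.exists_eq_mul
  have he0 : e ≠ 0 := by rintro rfl; norm_num at he8
  have hm0 : m ≠ 0 := hsm.ne_zero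
  have hpe : p.Coprime e.natAbs := by
    have h8 : p.Coprime 8 := by
      rw [show 8 = 2 ^ 3 by norm_num]
      exact Nat.Coprime.pow_right _ ((Nat.coprime_primes hp Nat.prime_two).2 hp2)
    exact h8.coprime_dvd_right (Int.natAbs_dvd_natAbs.2 he8)
  have hpm : p ∣ m.natAbs := by
    refine hpe.dvd_of_dvd_mul_left ?_
    rw [← Int.natAbs_mul]
    exact Int.natCast_dvd.1 hpD
  obtain ⟨k, hk⟩ := hpm
  have hk0 : k ≠ 0 := by rintro rfl; exact hm0 (Int.natAbs_eq_zero.1 (by simpa using hk))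
  have hpk : p.Coprime k := by
    have : Squarefree (p * k) := hk ▸ Int.squarefree_natAbs.2 hsm
    exact Nat.coprime_of_squarefree_mul this
  -- With `|m| = p k`, everything but `(n/p)` goes into the cofactor: the part at `e` and `(n/k)`.
  refine ⟨e.natAbs * k, by rw [Int.natAbs_mul, hk]; ring, hpe.mul_right hpk,
    fun n => ψ n * J(n | k), fun n₁ n₂ h => ?_, fun n hn => ?_⟩
  · rw [Nat.cast_mul] at h
    have h1 : n₁ ≡ n₂ [ZMOD e] := h.of_dvd ((Int.dvd_natAbs_self).mul_right _)
    have h2 : n₁ ≡ n₂ [ZMOD k] := h.of_dvd (Dvd.intro_left _ rfl)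
    simp only [hψ _ _ h1, jacobiSym.mod_left' h2]
  · have hn0 : n ≠ 0 := by
      rintro rfl
      rw [Int.gcd_zero_left] at hn
      have := Int.natCast_dvd.1 hpD
      rw [hn] at this
      exact hp.one_lt.ne' (Nat.dvd_one.1 this)
    rw [kroneckerSymbol_mul_left he0 hm0 hn0, hκ n hn0 hn, kroneckerSymbol_of_one_mod_four hm4 hn0,
      hk, jacobiSym.mul_right' _ hp.ne_zero hk0]
    ring

/-! ### From the density condition to divisibility -/

lemma eval_cubic (a b r : ℤ) :
    (Polynomial.C a * Polynomial.X ^ 3 + Polynomial.C b).eval r = a * r ^ 3 + b := by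
  simp

/-- If `τ_D⁻(f) = 1`, then some value of `f` is coprime to `D`, and the Kronecker symbol is `-1` at
all values of `f` coprime to `D`. -/
lemma kroneckerSymbol_eq_neg_one_of_tauMinus_eq_one {D : ℤ} {f : Polynomial ℤ}
    (hD : ¬IsUnit D) (hτ : tauMinus D f = 1) :
    (∃ r : ℤ, Int.gcd (f.eval r) D = 1) ∧
      ∀ r : ℕ, r < D.natAbs → Int.gcd (f.eval (r : ℤ)) D = 1 →
        kroneckerSymbol D (f.eval (r : ℤ)) = -1 := by
  unfold tauMinus at hτ
  set N := (Finset.range D.natAbs).filter fun r : ℕ =>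
      kroneckerSymbol D (f.eval (r : ℤ)) = -1 with hN
  set A := (Finset.range D.natAbs).filter fun r : ℕ => Int.gcd (f.eval (r : ℤ)) D = 1 with hA
  -- Division by zero yields 0, so a ratio equal to 1 forces an allowable class to exist.
  have hA0 : (A.card : ℚ) ≠ 0 := by
    intro h
    rw [h, div_zero] at hτ
    exact zero_ne_one hτ
  have hcard : N.card = A.card := by
    rw [div_eq_one_iff_eq hA0] at hτ
    exact_mod_cast hτ
  have hsub : N ⊆ A := by
    intro r hr
    obtain ⟨h1, h2⟩ := Finset.mem_filter.1 hr
    refine Finset.mem_filter.2 ⟨h1, ?_⟩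
    by_contra h
    rw [kroneckerSymbol_eq_zero_of_gcd_ne_one hD h] at h2
    norm_num at h2
  have heq := Finset.eq_of_subset_of_card_le hsub hcard.ge
  constructor
  · obtain ⟨r, hr⟩ := Finset.card_ne_zero.1 (fun h => hA0 (by rw [h, Nat.cast_zero]))
    exact ⟨r, (Finset.mem_filter.1 hr).2⟩
  · intro r hr h
    have : r ∈ N := heq ▸ Finset.mem_filter.2 ⟨Finset.mem_range.2 hr, h⟩
    exact (Finset.mem_filter.1 this).2

lemma dvd_of_tauMinus_eq_one {a b D : ℤ} (hD : IsFundamentalDiscriminant D)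
    (hτ : tauMinus D (Polynomial.C a * Polynomial.X ^ 3 + Polynomial.C b) = 1)
    {p : ℕ} (hp : p.Prime) (hp2 : p ≠ 2) (hp7 : p ≠ 7) (hpD : (p : ℤ) ∣ D) : (p : ℤ) ∣ a := by
  by_contra hpa
  have := Fact.mk hp
  obtain ⟨M, hDM, hpM, ψ, hψ, hκ⟩ := hD.exists_jacobiSym_mul hp hp2 hpD
  have hDu : ¬IsUnit D := by
    intro h
    exact (Nat.prime_iff_prime_int.1 hp).not_isUnit (isUnit_of_dvd_unit hpD h)
  have hD0 : D ≠ 0 := by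
    rintro rfl
    rcases hD with ⟨h, -⟩ | ⟨m, h, h', -⟩ <;> omega
  obtain ⟨⟨r₀, hr₀⟩, hall⟩ := kroneckerSymbol_eq_neg_one_of_tauMinus_eq_one hDu hτ
  simp only [eval_cubic] at hr₀ hall
  have ha : (a : ZMod p) ≠ 0 := by rwa [Ne, ZMod.intCast_zmod_eq_zero_iff_dvd]
  have key : ∀ ε : ℤ, ε = 1 ∨ ε = -1 → ε * ψ (a * r₀ ^ 3 + b) = -1 := by
    intro ε hε
    obtain ⟨x, hx⟩ := exists_quadraticChar_cubic_zmod hp2 hp7 (b : ZMod p) ha hε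
    have hDpos : 0 < D.natAbs := Int.natAbs_pos.2 hD0
    have hM0 : M ≠ 0 := by
      rintro rfl
      omega
    -- The class mod `p` prescribes the sign `ε`; the class mod `M` keeps `r₀`, which preserves both
    -- `ψ` and coprimality to `M`.
    obtain ⟨s, hsp, hsM⟩ := Nat.chineseRemainder hpM x.val (r₀ % M).toNat
    have hr : s % D.natAbs < D.natAbs := Nat.mod_lt _ hDpos
    set r := s % D.natAbs with hrdef
    have hrs : r ≡ s [MOD D.natAbs] := Nat.mod_modEq _ _
    have hrp : (r : ZMod p) = x := by
      have h : r ≡ x.val [MOD p] := (hrs.of_dvd (hDM ▸ Nat.dvd_mul_right p M)).trans hsp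
      rw [(ZMod.natCast_eq_natCast_iff _ _ _).2 h, ZMod.natCast_zmod_val]
    have hrM : (r : ℤ) ≡ r₀ [ZMOD M] := by
      have h := Int.natCast_modEq_iff.2 ((hrs.of_dvd (hDM ▸ Nat.dvd_mul_left M p)).trans hsM)
      rw [Int.toNat_of_nonneg (Int.emod_nonneg _ (by exact_mod_cast hM0))] at h
      exact h.trans (Int.mod_modEq _ _)
    have hfM : a * (r : ℤ) ^ 3 + b ≡ a * r₀ ^ 3 + b [ZMOD M] :=
      ((hrM.pow 3).mul_left a).add_right b
    have hJ : J(a * (r : ℤ) ^ 3 + b | p) = ε := by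
      rw [← jacobiSym.legendreSym.to_jacobiSym, legendreSym, ← hx]
      push_cast
      rw [hrp]
    have hgp : Int.gcd (a * (r : ℤ) ^ 3 + b) p = 1 := by
      by_contra h
      have := NeZero.mk hp.ne_zero
      rw [jacobiSym.eq_zero_iff_not_coprime.2 h] at hJ
      omega
    have hgM : Int.gcd (a * (r : ℤ) ^ 3 + b) M = 1 := by
      rw [← Int.gcd_emod, hfM, Int.gcd_emod]
      refine Nat.dvd_one.1 (hr₀ ▸ Int.gcd_dvd_gcd_of_dvd_right _ ?_)
      exact Int.natCast_dvd.2 (hDM ▸ Nat.dvd_mul_left M p)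
    have hg : Int.gcd (a * (r : ℤ) ^ 3 + b) D = 1 := by
      rw [Int.gcd_def, hDM]
      exact Nat.Coprime.mul_right hgp hgM
    have := hall r hr hg
    rwa [hκ _ hg, hJ, hψ _ _ hfM] at this
  have h1 := key 1 (Or.inl rfl)
  have h2 := key (-1) (Or.inr rfl)
  -- The same number `ψ (a * r₀ ^ 3 + b)` would be both `-1` and `1`.
  omega

theorem proposition5p6 (a b D : ℤ)
    (hprimes : ProducesInfinitelyManyPrimes
      (Polynomial.C a * Polynomial.X ^ 3 + Polynomial.C b))
    (hunif : PrimesUniformlyDistributed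
      (Polynomial.C a * Polynomial.X ^ 3 + Polynomial.C b))
    (hD : IsFundamentalDiscriminant D)
    (hτ : tauMinus D (Polynomial.C a * Polynomial.X ^ 3 + Polynomial.C b) = 1) :
    D ∣ 56 * a := by
  obtain ⟨e, m, hDe, hm4, hsm, he8, -⟩ := hD.exists_eq_mul
  -- The 8 absorbs `e`, the 7 absorbs the exceptional prime.
  rw [hDe, show 56 * a = 8 * (7 * a) by ring]
  refine mul_dvd_mul he8 ?_
  rw [← Int.natAbs_dvd_natAbs,
    ← Nat.prod_primeFactors_of_squarefree (Int.squarefree_natAbs.2 hsm)]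
  refine Finset.prod_primes_dvd _ (fun p hp => (Nat.prime_of_mem_primeFactors hp).prime)
    fun p hp => ?_
  have hpm : (p : ℤ) ∣ m := Int.natCast_dvd.2 (Nat.dvd_of_mem_primeFactors hp)
  rw [← Int.natCast_dvd]
  by_cases hp7 : p = 7
  · subst hp7
    exact Dvd.intro _ rfl
  · refine Dvd.dvd.mul_left (dvd_of_tauMinus_eq_one hD hτ (Nat.prime_of_mem_primeFactors hp) ?_ hp7
      (hDe ▸ hpm.mul_left e)) 7
    rintro rfl
    omega
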